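/- Let $\mathbb F_q$ be a finite field of odd characteristic and let $(G,G')$ be a symplectic-orthogonal dual pair: $G=\mathrm{Sp}_{2m}$ is the symplectic group of a nondegenerate alternating space over $\mathbb F_q$, $G'=\mathrm O_{2m'}$ is the orthogonal group of a nondegenerate symmetric bilinear space of even dimension over $\mathbb F_q$, and, as algebraic groups, the two are each other's centralizers in the symplectic group of the tensor product of these spaces. Let $G^*=\mathrm{SO}_{2m+1}$ and $G'^*=G'$ be their dual groups, and let $s\in G^*(\mathbb F_q)$, $s'\in G'^*(\mathbb F_q)$ be rational semisimple elements which are related by the Howe correspondence, that is: up to rational conjugacy $s=(t,1)$ and $s'=(t,1)$ for a common rational semisimple element $t$ of a special orthogonal group of a nondegenerate $2l$-dimensional space over $\mathbb F_q$, all of whose eigenvalues are different from $1$. (The space of $t$ embeds isometrically in the spaces of $G^*$ and $G'^*$; there $s$ and $s'$ act as $t$, and they act as the identity on its orthogonal complements.) For an eigenvalue $\lambda$ of $s$ in $\overline{\mathbb F}_q$ let $[\lambda]$ be its orbit under the Frobenius $x\mapsto x^q$ and inversion, and let $V_{[\lambda]}$ be the $\mathbb F_q$-subspace of the space of $G^*$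 which over $\overline{\mathbb F}_q$ becomes the sum of the eigenspaces of $s$ for the elements of $[\lambda]$. For $\lambda\ne 1$ let $G_{[\lambda]}(s)$ be the centralizer of $s|_{V_{[\lambda]}}$ in the full isometry group of $V_{[\lambda]}$ (so $G_{[-1]}(s)$ is the orthogonal group of the $(-1)$-eigenspace), and let $G_{[1]}(s)$ be the special orthogonal group of $V_{[1]}$; these are the factors in the decomposition of $C_{G^*}(s)$. Put $$G_\#=\prod_{[\lambda]\neq[1],[-1]}G_{[\lambda]}(s),\qquad G_{(-1)}=G_{[-1]}(s),\qquad G_{(1)}=\text{the dual group of }G_{[1]}(s),$$ and define $G'_\#$, $G'_{(-1)}$, $G'_{(1)}$ in the same way from $s'$ and $G'^*$, with $G'_{[1]}(s')$ the full orthogonal group of $V'_{[1]}$. Here the dual of $\mathrm{SO}_{2n+1}$ is $\mathrm{Sp}_{2n}$ and conversely, and the dual of $\mathrm O_{2n}$ is $\mathrm O_{2n}$ itself. Ranks equal to $0$ are allowed. Then $G_\#\cong G'_\#$ and $G_{(-1)}\cong G'_{(-1)}$ as algebraic groups over $\mathbb F_q$ (hence also their groups of rational points). Moreover, $G_{[1]}(s)$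 is a special orthogonal group of a nondegenerate odd-dimensional space, $G'_{[1]}(s')$ is an orthogonal group of a nondegenerate even-dimensional space, and $(G_{(1)},G'_{(1)})$ is again a symplectic-orthogonal dual pair. -/

import Mathlib

open scoped TensorProduct
open CategoryTheory

universe u

noncomputable section

/-- The kinds of classical groups that occur: full isometry groups of alternating forms,
isometries of determinant one of symmetric forms, and full isometry groups of symmetric forms. -/
inductive ClassicalKind
  | symplectic
  | specialOrthogonal
  | orthogonal

/-- A classical group over `R`, given by a free module of finite rank with a bilinear form.
Nondegeneracy and (anti)symmetry of the form are stated where they are needed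
(see `IsSymplecticOrthogonalDualPair`). -/
structure ClassicalGroup (R : Type u) [CommRing R] where
  kind : ClassicalKind
  space : Type u
  [addCommGroup : AddCommGroup space]
  [module : Module R space]
  [finite : Module.Finite R space]
  [free : Module.Free R space]
  form : LinearMap.BilinForm R space

attribute [instance] ClassicalGroup.addCommGroup ClassicalGroup.module
  ClassicalGroup.finite ClassicalGroup.free

namespace ClassicalGroup

section Points

variable {R : Type u} [CommRing R]

/-- The group of `R`-points: the isometries of the form, of determinant `1` in the special
orthogonal case. -/
def points (G : ClassicalGroup R) : Subgroup (LinearMap.GeneralLinearGroup R G.space) where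
  carrier := {g | (∀ x y, G.form ((g : Module.End R G.space) x) ((g : Module.End R G.space) y)
      = G.form x y) ∧
    (G.kind = .specialOrthogonal → LinearMap.det (g : Module.End R G.space) = 1)}
  one_mem' := by simp
  mul_mem' := by
    rintro a b ⟨ha, ha'⟩ ⟨hb, hb'⟩
    refine ⟨fun x y => ?_, fun h => ?_⟩
    · simp [ha, hb]
    · rw [Units.val_mul, map_mul, ha' h, hb' h, one_mul]
  inv_mem' := by
    rintro a ⟨ha, ha'⟩
    have key : ∀ x, (a : Module.End R G.space)
        (((a⁻¹ : (Module.End R G.space)ˣ) : Module.End R G.space) x) = x := by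
      intro x
      rw [← Module.End.mul_apply, Units.mul_inv, Module.End.one_apply]
    refine ⟨fun x y => ?_, fun h => ?_⟩
    · rw [← ha, key, key]
    · have h1 : LinearMap.det (a : Module.End R G.space) *
          LinearMap.det ((a⁻¹ : (Module.End R G.space)ˣ) : Module.End R G.space) = 1 := by
        rw [← map_mul, Units.mul_inv, map_one]
      rwa [ha' h, one_mul] at h1

/-- Extension of scalars of a classical group. -/
def baseChange (G : ClassicalGroup R) (A : Type u) [CommRing A] [Algebra R A] :
    ClassicalGroup A where
  kind := G.kind
  space := A ⊗[R] G.space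
  form := LinearMap.BilinForm.baseChange A G.form

end Points

section Functor

variable {K : Type u} [Field K]

section BaseMap

variable (V : Type u) [AddCommGroup V] [Module K V]
  {A B C : Type u} [CommRing A] [Algebra K A] [CommRing B] [Algebra K B]
  [CommRing C] [Algebra K C]

/-- The action of a homomorphism of `K`-algebras `A → B` on endomorphisms,
`End_A (A ⊗ V) → End_B (B ⊗ V)`: entrywise application of the homomorphism in any
`K`-basis of `V`. -/
def endMapFun (f : A →ₐ[K] B) (g : Module.End A (A ⊗[K] V)) : Module.End B (B ⊗[K] V) :=
  LinearMap.liftBaseChange B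
    ((LinearMap.rTensor V f.toLinearMap) ∘ₗ (g.restrictScalars K) ∘ₗ
      (TensorProduct.mk K A V 1))

variable {V}

theorem endMapFun_rTensor (f : A →ₐ[K] B) (g : Module.End A (A ⊗[K] V)) (x : A ⊗[K] V) :
    endMapFun V f g (LinearMap.rTensor V f.toLinearMap x)
      = LinearMap.rTensor V f.toLinearMap (g x) := by
  have smul_r : ∀ (a : A) (y : A ⊗[K] V), LinearMap.rTensor V f.toLinearMap (a • y)
      = f a • LinearMap.rTensor V f.toLinearMap y := by
    intro a y
    induction y with
    | zero => simp
    | tmul b v => simp [TensorProduct.smul_tmul']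
    | add y z hy hz => rw [smul_add, map_add, hy, hz, map_add, smul_add]
  induction x with
  | zero => simp
  | tmul a v =>
    have : (a ⊗ₜ[K] v : A ⊗[K] V) = a • ((1 : A) ⊗ₜ[K] v) := by
      simp [TensorProduct.smul_tmul']
    rw [this, g.map_smul, smul_r, smul_r, (endMapFun V f g).map_smul]
    simp [endMapFun]
  | add y z hy hz => simp only [map_add, hy, hz]

theorem end_ext_one {g h : Module.End B (B ⊗[K] V)}
    (H : ∀ v : V, g (1 ⊗ₜ v) = h (1 ⊗ₜ v)) : g = h := by
  apply TensorProduct.AlgebraTensorModule.curry_injective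
  ext v
  simpa using H v

theorem rTensor_one_tmul (f : A →ₐ[K] B) (v : V) :
    LinearMap.rTensor V f.toLinearMap ((1 : A) ⊗ₜ[K] v) = (1 : B) ⊗ₜ[K] v := by
  simp

theorem endMapFun_one_tmul (f : A →ₐ[K] B) (g : Module.End A (A ⊗[K] V)) (v : V) :
    endMapFun V f g (1 ⊗ₜ v) = LinearMap.rTensor V f.toLinearMap (g (1 ⊗ₜ v)) := by
  rw [← endMapFun_rTensor, rTensor_one_tmul]

variable (V)

/-- `endMapFun` as a homomorphism of monoids. -/
def endMap (f : A →ₐ[K] B) : Module.End A (A ⊗[K] V) →* Module.End B (B ⊗[K] V) where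
  toFun := endMapFun V f
  map_one' := end_ext_one fun v => by rw [endMapFun_one_tmul]; simp
  map_mul' g h := end_ext_one fun v => by
    rw [endMapFun_one_tmul, Module.End.mul_apply, Module.End.mul_apply, endMapFun_one_tmul,
      endMapFun_rTensor]

variable {V}

theorem endMap_one_tmul (f : A →ₐ[K] B) (g : Module.End A (A ⊗[K] V)) (v : V) :
    endMap V f g (1 ⊗ₜ v) = LinearMap.rTensor V f.toLinearMap (g (1 ⊗ₜ v)) :=
  endMapFun_one_tmul f g v

theorem endMap_id (g : Module.End A (A ⊗[K] V)) : endMap V (AlgHom.id K A) g = g :=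
  end_ext_one fun v => by
    rw [endMap_one_tmul]
    have : (AlgHom.id K A).toLinearMap = LinearMap.id := rfl
    rw [this, LinearMap.rTensor_id, LinearMap.id_apply]

theorem endMap_comp (f : A →ₐ[K] B) (f' : B →ₐ[K] C) (g : Module.End A (A ⊗[K] V)) :
    endMap V (f'.comp f) g = endMap V f' (endMap V f g) :=
  end_ext_one fun v => by
    rw [endMap_one_tmul, endMap_one_tmul, endMap_one_tmul, AlgHom.comp_toLinearMap,
      LinearMap.rTensor_comp, LinearMap.comp_apply]

theorem endMap_baseChange (f : A →ₐ[K] B) (s : Module.End K V) :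
    endMap V f (s.baseChange A) = s.baseChange B :=
  end_ext_one fun v => by rw [endMap_one_tmul]; simp

theorem form_rTensor (β : LinearMap.BilinForm K V) (f : A →ₐ[K] B) (x y : A ⊗[K] V) :
    LinearMap.BilinForm.baseChange B β (LinearMap.rTensor V f.toLinearMap x)
      (LinearMap.rTensor V f.toLinearMap y)
      = f (LinearMap.BilinForm.baseChange A β x y) := by
  induction x with
  | zero => simp
  | tmul a v =>
    induction y with
    | zero => simp
    | tmul b w => simp
    | add y z hy hz => simp only [map_add, hy, hz]
  | add y z hy hz => simp only [map_add, LinearMap.add_apply, hy, hz]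

theorem form_endMap (β : LinearMap.BilinForm K V) (f : A →ₐ[K] B)
    (g : Module.End A (A ⊗[K] V))
    (hg : ∀ x y, LinearMap.BilinForm.baseChange A β (g x) (g y)
      = LinearMap.BilinForm.baseChange A β x y) (x y : B ⊗[K] V) :
    LinearMap.BilinForm.baseChange B β (endMap V f g x) (endMap V f g y)
      = LinearMap.BilinForm.baseChange B β x y := by
  have h1 : ∀ (b : B) (v : V), (b ⊗ₜ[K] v : B ⊗[K] V) = b • ((1 : B) ⊗ₜ[K] v) := by
    intro b v
    simp [TensorProduct.smul_tmul']
  induction x with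
  | zero => simp
  | tmul a v =>
    induction y with
    | zero => simp
    | tmul b w =>
      have h2 : LinearMap.BilinForm.baseChange B β (endMap V f g (1 ⊗ₜ v))
          (endMap V f g (1 ⊗ₜ w)) =
          LinearMap.BilinForm.baseChange B β (1 ⊗ₜ v) (1 ⊗ₜ w) := by
        rw [endMap_one_tmul, endMap_one_tmul, form_rTensor, hg, ← form_rTensor,
          rTensor_one_tmul, rTensor_one_tmul]
      rw [h1 a, h1 b]
      simp only [map_smul, LinearMap.smul_apply, h2]
    | add y z hy hz => simp only [map_add, hy, hz]
  | add y z hy hz => simp only [map_add, LinearMap.add_apply, hy, hz]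

theorem det_endMap [Module.Finite K V] (f : A →ₐ[K] B) (g : Module.End A (A ⊗[K] V)) :
    LinearMap.det (endMap V f g) = f (LinearMap.det g) := by
  let b := Module.finBasis K V
  rw [← LinearMap.det_toMatrix (b.baseChange B), ← LinearMap.det_toMatrix (b.baseChange A),
    AlgHom.map_det]
  congr 1
  ext i j
  rw [AlgHom.mapMatrix_apply, Matrix.map_apply, LinearMap.toMatrix_apply,
    LinearMap.toMatrix_apply, Module.Basis.baseChange_apply, Module.Basis.baseChange_apply,
    endMap_one_tmul]
  generalize g (1 ⊗ₜ b j) = x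
  induction x with
  | zero => simp
  | tmul a v => simp
  | add y z hy hz => simp only [map_add, Finsupp.add_apply, hy, hz]

end BaseMap

/-- The `A`-points of the centralizer of `s` in `G`. -/
def centralizerPoints (G : ClassicalGroup K) (s : Module.End K G.space)
    (A : Type u) [CommRing A] [Algebra K A] :
    Subgroup (LinearMap.GeneralLinearGroup A (A ⊗[K] G.space)) where
  carrier := {g | g ∈ (G.baseChange A).points ∧
    (g : Module.End A (A ⊗[K] G.space)) * s.baseChange A = s.baseChange A * g}
  one_mem' := ⟨(G.baseChange A).points.one_mem, by simp⟩
  mul_mem' := by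
    rintro a b ⟨ha, ha'⟩ ⟨hb, hb'⟩
    refine ⟨(G.baseChange A).points.mul_mem ha hb, ?_⟩
    rw [Units.val_mul, mul_assoc, hb', ← mul_assoc, ha', mul_assoc]
  inv_mem' := by
    rintro a ⟨ha, ha'⟩
    refine ⟨(G.baseChange A).points.inv_mem ha, ?_⟩
    rw [Units.inv_mul_eq_iff_eq_mul, ← mul_assoc, ha', mul_assoc, Units.mul_inv, mul_one]

theorem map_mem_centralizerPoints (G : ClassicalGroup K) (s : Module.End K G.space)
    {A B : Type u} [CommRing A] [Algebra K A] [CommRing B] [Algebra K B] (f : A →ₐ[K] B)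
    {g : LinearMap.GeneralLinearGroup A (A ⊗[K] G.space)} (hg : g ∈ G.centralizerPoints s A) :
    Units.map (endMap G.space f) g ∈ G.centralizerPoints s B := by
  obtain ⟨⟨h1, h2⟩, h3⟩ := hg
  refine ⟨⟨fun x y => form_endMap G.form f _ h1 x y, fun h => ?_⟩, ?_⟩
  · have h2' : LinearMap.det (g : Module.End A (A ⊗[K] G.space)) = 1 := h2 h
    change LinearMap.det (endMap G.space f (g : Module.End A (A ⊗[K] G.space))) = 1
    rw [det_endMap, h2', map_one]
  · rw [Units.coe_map, ← endMap_baseChange f s, ← map_mul, h3, map_mul]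

/-- The centralizer of `s` in `G`, as an algebraic group over `K` (through its functor of
points). -/
def centralizer (G : ClassicalGroup K) (s : Module.End K G.space) :
    CommAlgCat.{u} K ⥤ GrpCat.{u} where
  obj A := GrpCat.of (G.centralizerPoints s A)
  map {A B} f := GrpCat.ofHom
    (((Units.map (endMap G.space f.hom)).comp (G.centralizerPoints s A).subtype).codRestrict
      (G.centralizerPoints s B) fun g => G.map_mem_centralizerPoints s f.hom g.2)
  map_id A := by
    refine GrpCat.hom_ext (MonoidHom.ext fun g => Subtype.ext (Units.ext ?_))
    exact endMap_id _
  map_comp {A B C} f f' := by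
    refine GrpCat.hom_ext (MonoidHom.ext fun g => Subtype.ext (Units.ext ?_))
    exact endMap_comp f.hom f'.hom _

end Functor

section Dual

variable {K : Type u} [Field K]

/-- `G` belongs to one of the families `Sp_{2n}`, `SO_{2n+1}`, `O_{2n}`, for which the dual group
is defined. -/
def IsInDualFamily (G : ClassicalGroup K) : Prop :=
  G.form.Nondegenerate ∧
    match G.kind with
    | .symplectic => G.form.IsAlt
    | .specialOrthogonal => G.form.IsSymm ∧ Odd (Module.finrank K G.space)
    | .orthogonal => G.form.IsSymm ∧ Even (Module.finrank K G.space)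

/-- The Langlands dual `G^*` of a classical group: the dual of `Sp_{2n}` is the split
`SO_{2n+1}`, the dual of `SO_{2n+1}` is `Sp_{2n}`, and an even orthogonal group is its own dual.
(It is only meaningful under `IsInDualFamily`.)  Here `SO_{2n+1}` is taken for the form
`∑ (a i * d i + b i * c i) + x * y` and `Sp_{2n}` for the form `∑ (a i * d i - b i * c i)` of
`(a, b, x)`, `(c, d, y)`. -/
def dual (G : ClassicalGroup K) : ClassicalGroup K :=
  match G.kind with
  | .symplectic =>
    { kind := .specialOrthogonal
      space := ((Fin (Module.finrank K G.space / 2) → K) ×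
        (Fin (Module.finrank K G.space / 2) → K)) × K
      form := LinearMap.mk₂ K
        (fun v w => v.1.1 ⬝ᵥ w.1.2 + v.1.2 ⬝ᵥ w.1.1 + v.2 * w.2)
        (by intros; simp only [Prod.fst_add, Prod.snd_add, add_dotProduct]; ring)
        (by intros; simp only [Prod.smul_fst, Prod.smul_snd, smul_dotProduct, smul_eq_mul]; ring)
        (by intros; simp only [Prod.fst_add, Prod.snd_add, dotProduct_add]; ring)
        (by intros; simp only [Prod.smul_fst, Prod.smul_snd, dotProduct_smul, smul_eq_mul]
            ring) }
  | .specialOrthogonal =>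
    { kind := .symplectic
      space := (Fin (Module.finrank K G.space / 2) → K) ×
        (Fin (Module.finrank K G.space / 2) → K)
      form := LinearMap.mk₂ K
        (fun v w => v.1 ⬝ᵥ w.2 - v.2 ⬝ᵥ w.1)
        (by intros; simp only [Prod.fst_add, Prod.snd_add, add_dotProduct]; ring)
        (by intros; simp only [Prod.smul_fst, Prod.smul_snd, smul_dotProduct, smul_eq_mul]; ring)
        (by intros; simp only [Prod.fst_add, Prod.snd_add, dotProduct_add]; ring)
        (by intros; simp only [Prod.smul_fst, Prod.smul_snd, dotProduct_smul, smul_eq_mul]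
            ring) }
  | .orthogonal => G

end Dual

section DualPair

variable {L : Type u} [Field L]

/-- The group of isometries of the form `ω ⊗ β` on `W ⊗ E`, where `(W, ω)` and `(E, β)` are the
formed spaces of `G` and `G'`. If `ω` is alternating and `β` symmetric, it is a symplectic
group. -/
def tensor (G G' : ClassicalGroup L) : ClassicalGroup L where
  kind := .symplectic
  space := G.space ⊗[L] G'.space
  form := LinearMap.BilinForm.tmul G.form G'.form

/-- The image of `G` in the isometry group of `W ⊗ E`, acting on the first factor. -/
def leftImage (G G' : ClassicalGroup L) :
    Subgroup (LinearMap.GeneralLinearGroup L (tensor G G').space) :=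
  G.points.map (Units.map (Module.End.rTensorAlgHom L G.space G'.space :
    Module.End L G.space →* Module.End L (G.space ⊗[L] G'.space)))

/-- The image of `G'` in the isometry group of `W ⊗ E`, acting on the second factor. -/
def rightImage (G G' : ClassicalGroup L) :
    Subgroup (LinearMap.GeneralLinearGroup L (tensor G G').space) :=
  G'.points.map (Units.map (Module.End.lTensorAlgHom L G'.space G.space :
    Module.End L G'.space →* Module.End L (G.space ⊗[L] G'.space)))

/-- Inside the isometry group of `W ⊗ E`, each of the images of `G` and `G'` is the centralizer
of the other. -/
def MutualCentralizers (G G' : ClassicalGroup L) : Prop :=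
  leftImage G G' = (tensor G G').points ⊓
      Subgroup.centralizer ↑(rightImage G G') ∧
    rightImage G G' = (tensor G G').points ⊓
      Subgroup.centralizer ↑(leftImage G G')

variable {K : Type u} [Field K]

/-- `(G, G')` is a symplectic-orthogonal dual pair `(Sp_{2m}, O_{2m'})` over `K`: the group `G` is
the symplectic group of a nondegenerate alternating form, `G'` is the orthogonal group of a
nondegenerate symmetric form in even dimension, and, as algebraic groups (that is, over the
algebraic closure), they are each other's centralizers in the symplectic group of the tensor
product. -/
structure IsSymplecticOrthogonalDualPair (G G' : ClassicalGroup K) : Prop where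
  kind_left : G.kind = .symplectic
  alt_left : G.form.IsAlt
  nondegenerate_left : G.form.Nondegenerate
  kind_right : G'.kind = .orthogonal
  symm_right : G'.form.IsSymm
  nondegenerate_right : G'.form.Nondegenerate
  even_right : Even (Module.finrank K G'.space)
  centralizers : MutualCentralizers (G.baseChange (AlgebraicClosure K))
    (G'.baseChange (AlgebraicClosure K))

end DualPair

section Centralizers

variable {K : Type u} [Field K]

/-- The class `[x]` of an eigenvalue `x` in the algebraic closure of the finite field `K`: its
orbit under the Frobenius endomorphism and inversion. (The eigenvalues of an isometry come in
pairs `x, x⁻¹`.) -/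
def eigenvalueClass (x : AlgebraicClosure K) : Set (AlgebraicClosure K) :=
  {y | ∃ i : ℕ, y = x ^ (Nat.card K ^ i) ∨ y = (x ^ (Nat.card K ^ i))⁻¹}

/-- The subspace of `V` that becomes, over the algebraic closure, the sum of the eigenspaces of
`s` for the eigenvalues in `O`. -/
def eigenvalueSpace {V : Type u} [AddCommGroup V] [Module K V] (s : Module.End K V)
    (O : Set (AlgebraicClosure K)) : Submodule K V :=
  ((⨆ x ∈ O, Module.End.eigenspace (s.baseChange (AlgebraicClosure K)) x).restrictScalars
    K).comap (TensorProduct.mk K (AlgebraicClosure K) V 1)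

theorem apply_mem_eigenvalueSpace {V : Type u} [AddCommGroup V] [Module K V]
    (s : Module.End K V) (O : Set (AlgebraicClosure K)) :
    ∀ v ∈ eigenvalueSpace s O, s v ∈ eigenvalueSpace s O := by
  intro v hv
  have key : (⨆ x ∈ O, Module.End.eigenspace (s.baseChange (AlgebraicClosure K)) x) ≤
      (⨆ x ∈ O, Module.End.eigenspace (s.baseChange (AlgebraicClosure K)) x).comap
        (s.baseChange (AlgebraicClosure K)) := by
    refine iSup₂_le fun x hx w hw => ?_
    rw [Submodule.mem_comap, Module.End.mem_eigenspace_iff.mp hw]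
    exact Submodule.smul_mem _ _ (Submodule.mem_iSup_of_mem x
      (Submodule.mem_iSup_of_mem hx hw))
  have h := key hv
  rw [Submodule.mem_comap, TensorProduct.mk_apply, LinearMap.baseChange_tmul] at h
  exact h

/-- The classical group of kind `k` on the part of the space of `H` that belongs to the
eigenvalues of `s` in `O`. -/
def part (H : ClassicalGroup K) (s : Module.End K H.space) (k : ClassicalKind)
    (O : Set (AlgebraicClosure K)) : ClassicalGroup K where
  kind := k
  space := eigenvalueSpace s O
  form := H.form.restrict (eigenvalueSpace s O)

/-- For `H = G^*`, the factor `G_[x](s)` of the centralizer of `s` in `H`, for a class `O = [x]`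
with `x ≠ 1`: the centralizer of `s` in the full isometry group of the part of the space that
belongs to `[x]`. For `x = -1`, where `s` acts as a scalar, it is the orthogonal group of
the eigenspace of `s` for `-1`. -/
def factor (H : ClassicalGroup K) (s : Module.End K H.space) (O : Set (AlgebraicClosure K)) :
    CommAlgCat.{u} K ⥤ GrpCat.{u} :=
  (H.part s .orthogonal O).centralizer (s.restrict (apply_mem_eigenvalueSpace s O))

/-- The classes `[x]` of the eigenvalues `x ≠ 1, -1` of `s`. -/
def NontrivialClass (H : ClassicalGroup K) (s : Module.End K H.space) : Type u :=
  {O : Set (AlgebraicClosure K) // ∃ x : AlgebraicClosure K, x ≠ 1 ∧ x ≠ -1 ∧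
    Module.End.HasEigenvalue (s.baseChange (AlgebraicClosure K)) x ∧ O = eigenvalueClass x}

/-- For `H = G^*`, the algebraic group `G_#`, the product of the `G_[x](s)` for `x ≠ 1, -1`. -/
def sharp (H : ClassicalGroup K) (s : Module.End K H.space) :
    CommAlgCat.{u} K ⥤ GrpCat.{u} :=
  ∏ᶜ fun O : NontrivialClass H s => H.factor s O.1

/-- For `H = G^*`, the algebraic group `G_(-1) = G_[-1](s)`. -/
def minusOnePart (H : ClassicalGroup K) (s : Module.End K H.space) :
    CommAlgCat.{u} K ⥤ GrpCat.{u} :=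
  H.factor s (eigenvalueClass (-1))

/-- For `H = G^*`, the factor `G_[1](s)`: the group of the same kind as `H` on the space of
vectors fixed by `s`. -/
def onePart (H : ClassicalGroup K) (s : Module.End K H.space) : ClassicalGroup K :=
  H.part s H.kind (eigenvalueClass 1)

/-- `s = (t, 1)`, up to conjugation: the space of `H` contains an isometric copy of the formed
space of `T`, stable under `s`, on which `s` acts as `t`, and `s` is the identity on its
orthogonal complement. -/
def IsBlockSum (H : ClassicalGroup K) (s : Module.End K H.space)
    (T : ClassicalGroup K) (t : Module.End K T.space) : Prop :=
  ∃ i : T.space →ₗ[K] H.space, (∀ x y, H.form (i x) (i y) = T.form x y) ∧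
    (∀ x, s (i x) = i (t x)) ∧
    ∀ y, (∀ x, H.form (i x) y = 0) → s y = y

/-- The relation between the semisimple classes of the dual groups `H = G^*` and `H' = G'^*` under
the Howe correspondence: there are `l` and a rational semisimple element `t` of a special
orthogonal group in dimension `2 l`, all of whose eigenvalues are different from `1`, such that
`s = (t, 1)` and `s' = (t, 1)`. -/
def HoweRelated (H H' : ClassicalGroup K) (s : Module.End K H.space)
    (s' : Module.End K H'.space) : Prop :=
  ∃ T : ClassicalGroup K, T.kind = .specialOrthogonal ∧ T.form.IsSymm ∧
    T.form.Nondegenerate ∧ (∃ l : ℕ, Module.finrank K T.space = 2 * l) ∧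
    ∃ t ∈ T.points, Module.End.IsSemisimple (t : Module.End K T.space) ∧
      ¬ Module.End.HasEigenvalue (t : Module.End K T.space) 1 ∧
      IsBlockSum H s T t ∧ IsBlockSum H' s' T t

end Centralizers

end ClassicalGroup

end

/-!
The relation `s = (t, 1)`, `s' = (t, 1)` reduces everything to the common element `t`. Let `i` be
the isometric embedding of the space of `t` into the space of `s`. As the space of `t` is
nondegenerate, `i` has an adjoint `q`, which is an equivariant retraction of `i`; and `s` is the
identity on `ker q`, the orthogonal complement of the image (`IsBlockSum.exists_retraction`).

Eigenvectors of `s`, over any field extension, for an eigenvalue `x ≠ 1` have no component in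
`ker q`. Hence `i` identifies the part of `t` with the part of `s` for every set of eigenvalues that
does not contain `1` (`eigenvalueSpaceEquiv`), compatibly with the forms and the operators, and
therefore identifies the factors of the centralizers (`factorIso`, through `centralizerIso`). The
same holds for `s'`. Going through `t` gives the isomorphisms for `G_#` and `G_(-1)`.

As `1` is not an eigenvalue of `t`, the fixed space of `s` is exactly `ker q`
(`eigenvalueSpace_one_eq_ker`). It is nondegenerate, and its dimension has the parity of that of the
whole space, since the space of `t` has even dimension.

It remains to see that any nondegenerate alternating space and any nondegenerate symmetric space of
even dimension give a dual pair (`isSymplecticOrthogonalDualPair`). Over the algebraic closure, the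
transvections and the reflections generate all rank one operators under products and linear
combinations (`smulRight_mem_of_span`). So an operator on `W ⊗ E` that centralizes `O(E)` commutes
with `1 ⊗ End E`, and is of the form `g ⊗ 1` (`exists_eq_rTensor_of_commute`); if it is an isometry,
then so is `g`. The same argument applies to the centralizer of `Sp(W)`.
-/

noncomputable section

namespace ClassicalGroup

/-! ### Transport of centralizers along isometries -/

section Transport

variable {K : Type u} [Field K]

theorem form_baseChange_map {V W : Type u} [AddCommGroup V] [Module K V] [AddCommGroup W]
    [Module K W] {β : LinearMap.BilinForm K V} {γ : LinearMap.BilinForm K W} (φ : V →ₗ[K] W)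
    (hφ : ∀ x y, γ (φ x) (φ y) = β x y) (A : Type u) [CommRing A] [Algebra K A]
    (x y : A ⊗[K] V) :
    LinearMap.BilinForm.baseChange A γ (φ.baseChange A x) (φ.baseChange A y)
      = LinearMap.BilinForm.baseChange A β x y := by
  induction x with
  | zero => simp
  | add x x' hx hx' => simp only [map_add, LinearMap.add_apply, hx, hx']
  | tmul a v =>
    induction y with
    | zero => simp
    | add y y' hy hy' => simp only [map_add, hy, hy']
    | tmul b w => simp [hφ]

variable {G₁ G₂ : ClassicalGroup K} (φ : G₁.space ≃ₗ[K] G₂.space)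

/-- Conjugation by the extension of scalars of `φ`. -/
def conjUnits (A : Type u) [CommRing A] [Algebra K A] :
    LinearMap.GeneralLinearGroup A (A ⊗[K] G₁.space) →*
      LinearMap.GeneralLinearGroup A (A ⊗[K] G₂.space) :=
  Units.map ((φ.baseChange K A _ _).conjRingEquiv : _ →* Module.End A (A ⊗[K] G₂.space))

/-- Conjugation by an isometry that intertwines `s₁` and `s₂` maps the centralizer of `s₁` to that
of `s₂`. -/
theorem conj_mem_centralizerPoints (hk : G₁.kind = G₂.kind)
    (hφ : ∀ x y, G₂.form (φ x) (φ y) = G₁.form x y)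
    {s₁ : Module.End K G₁.space} {s₂ : Module.End K G₂.space} (hs : ∀ x, φ (s₁ x) = s₂ (φ x))
    {A : Type u} [CommRing A] [Algebra K A]
    {g : LinearMap.GeneralLinearGroup A (A ⊗[K] G₁.space)} (hg : g ∈ G₁.centralizerPoints s₁ A) :
    conjUnits φ A g ∈ G₂.centralizerPoints s₂ A := by
  obtain ⟨⟨h1, h2⟩, h3⟩ := hg
  have hφ' : ∀ x y : A ⊗[K] G₁.space,
      LinearMap.BilinForm.baseChange A G₂.form (φ.baseChange K A _ _ x) (φ.baseChange K A _ _ y)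
        = LinearMap.BilinForm.baseChange A G₁.form x y :=
    form_baseChange_map φ.toLinearMap hφ A
  have hs' : ∀ x : A ⊗[K] G₁.space, φ.baseChange K A _ _ (s₁.baseChange A x)
      = s₂.baseChange A (φ.baseChange K A _ _ x) := by
    intro x
    induction x with
    | zero => simp
    | add x y hx hy => simp only [map_add, hx, hy]
    | tmul a v => simp [hs]
  refine ⟨⟨fun x y => ?_, fun h => ?_⟩, ?_⟩
  · have e := h1 ((φ.baseChange K A _ _).symm x) ((φ.baseChange K A _ _).symm y)
    exact (hφ' _ _).trans (e.trans ((hφ' _ _).symm.trans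
      (congrArg₂ (fun x y => LinearMap.BilinForm.baseChange A G₂.form x y)
        (LinearEquiv.apply_symm_apply _ x) (LinearEquiv.apply_symm_apply _ y))))
  · have h2' : LinearMap.det (g : Module.End A (A ⊗[K] G₁.space)) = 1 := h2 (hk.trans h)
    rw [← h2']
    exact LinearMap.det_conj (g : Module.End A (A ⊗[K] G₁.space)) (φ.baseChange K A _ _)
  · refine LinearMap.ext fun x => ?_
    obtain ⟨x, rfl⟩ := (φ.baseChange K A _ _).surjective x
    have e := congrArg (φ.baseChange K A _ _) (LinearMap.congr_fun h3 x)
    rw [Module.End.mul_apply, Module.End.mul_apply, hs'] at e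
    change φ.baseChange K A _ _ ((g : Module.End A (A ⊗[K] G₁.space))
      ((φ.baseChange K A _ _).symm (s₂.baseChange A (φ.baseChange K A _ _ x)))) =
      s₂.baseChange A (φ.baseChange K A _ _ ((g : Module.End A (A ⊗[K] G₁.space))
      ((φ.baseChange K A _ _).symm (φ.baseChange K A _ _ x))))
    rw [← hs', LinearEquiv.symm_apply_apply, LinearEquiv.symm_apply_apply, e]

/-- Conjugation by an isometry `φ` that intertwines `s₁` and `s₂`, as a homomorphism between the
`A`-points of the centralizers of `s₁` and `s₂`. -/
def centralizerPointsConj (hk : G₁.kind = G₂.kind)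
    (hφ : ∀ x y, G₂.form (φ x) (φ y) = G₁.form x y)
    {s₁ : Module.End K G₁.space} {s₂ : Module.End K G₂.space} (hs : ∀ x, φ (s₁ x) = s₂ (φ x))
    (A : Type u) [CommRing A] [Algebra K A] :
    G₁.centralizerPoints s₁ A →* G₂.centralizerPoints s₂ A where
  toFun g := ⟨conjUnits φ A g, conj_mem_centralizerPoints φ hk hφ hs g.2⟩
  map_one' := Subtype.ext (map_one _)
  map_mul' _ _ := Subtype.ext (map_mul _ _ _)

/-- Conjugation by `φ` is natural in the algebra of scalars. -/
theorem conj_endMap {A B : Type u} [CommRing A] [Algebra K A] [CommRing B] [Algebra K B]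
    (f : A →ₐ[K] B) (g : Module.End A (A ⊗[K] G₁.space)) :
    (φ.baseChange K B _ _).conjRingEquiv (endMap G₁.space f g)
      = endMap G₂.space f ((φ.baseChange K A _ _).conjRingEquiv g) := by
  refine end_ext_one fun v => ?_
  have key : ∀ x : A ⊗[K] G₁.space,
      φ.baseChange K B _ _ (LinearMap.rTensor G₁.space f.toLinearMap x)
        = LinearMap.rTensor G₂.space f.toLinearMap (φ.baseChange K A _ _ x) := by
    intro x
    induction x with
    | zero => simp
    | add x y hx hy => simp only [map_add, hx, hy]
    | tmul a v => simp
  have hv : ∀ C : Type u, ∀ [CommRing C] [Algebra K C],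
      (φ.baseChange K C _ _).symm (1 ⊗ₜ v) = 1 ⊗ₜ φ.symm v := by
    intro C _ _
    rw [LinearEquiv.symm_apply_eq]
    simp
  rw [endMap_one_tmul, LinearEquiv.conjRingEquiv_apply_apply,
    LinearEquiv.conjRingEquiv_apply_apply, hv, hv, endMap_one_tmul, key]

/-- `centralizerPointsConj` as a homomorphism of algebraic groups. -/
def centralizerConj (hk : G₁.kind = G₂.kind)
    (hφ : ∀ x y, G₂.form (φ x) (φ y) = G₁.form x y)
    {s₁ : Module.End K G₁.space} {s₂ : Module.End K G₂.space} (hs : ∀ x, φ (s₁ x) = s₂ (φ x)) :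
    G₁.centralizer s₁ ⟶ G₂.centralizer s₂ where
  app A := GrpCat.ofHom (centralizerPointsConj φ hk hφ hs A)
  naturality _ _ f := GrpCat.hom_ext (MonoidHom.ext fun _ => Subtype.ext (Units.ext
    (conj_endMap φ f.hom _)))

/-- An isometry that intertwines `s₁` and `s₂` identifies their centralizers. -/
def centralizerIso (hk : G₁.kind = G₂.kind)
    (hφ : ∀ x y, G₂.form (φ x) (φ y) = G₁.form x y)
    {s₁ : Module.End K G₁.space} {s₂ : Module.End K G₂.space} (hs : ∀ x, φ (s₁ x) = s₂ (φ x)) :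
    G₁.centralizer s₁ ≅ G₂.centralizer s₂ where
  hom := centralizerConj φ hk hφ hs
  inv := centralizerConj φ.symm hk.symm (fun x y => by rw [← hφ]; simp)
    (fun x => by rw [LinearEquiv.symm_apply_eq, hs]; simp)
  hom_inv_id := NatTrans.ext (funext fun A => GrpCat.hom_ext (MonoidHom.ext fun g =>
    Subtype.ext (Units.ext (RingEquiv.symm_apply_apply (φ.baseChange K A _ _).conjRingEquiv
      (Subtype.val (p := (· ∈ G₁.centralizerPoints s₁ A)) g).1))))
  inv_hom_id := NatTrans.ext (funext fun A => GrpCat.hom_ext (MonoidHom.ext fun g =>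
    Subtype.ext (Units.ext (RingEquiv.apply_symm_apply (φ.baseChange K A _ _).conjRingEquiv
      (Subtype.val (p := (· ∈ G₂.centralizerPoints s₂ A)) g).1))))

end Transport

/-! ### Block sums -/

section BlockSum

variable {K : Type u} [Field K]

/-- If `s = (t, 1)` along the isometric embedding `i` of the nondegenerate space of `T`, then the
adjoint `q` of `i` is an equivariant retraction of `i`, and `s` is the identity on the complement
`ker q` of the image of `i`. -/
theorem IsBlockSum.exists_retraction {H T : ClassicalGroup K}
    {s : LinearMap.GeneralLinearGroup K H.space} (hs : s ∈ H.points)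
    {t : LinearMap.GeneralLinearGroup K T.space} (ht : t ∈ T.points)
    (hsymm : T.form.IsSymm) (hT : T.form.Nondegenerate)
    (h : IsBlockSum H (s : Module.End K H.space) T (t : Module.End K T.space)) :
    ∃ (i : T.space →ₗ[K] H.space) (q : H.space →ₗ[K] T.space),
      (∀ x y, H.form (i x) (i y) = T.form x y) ∧
      (∀ x, (s : Module.End K H.space) (i x) = i ((t : Module.End K T.space) x)) ∧
      (∀ x, q (i x) = x) ∧
      (∀ y, q ((s : Module.End K H.space) y) = (t : Module.End K T.space) (q y)) ∧
      (∀ y, (s : Module.End K H.space) (y - i (q y)) = y - i (q y)) ∧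
      ∀ x y, H.form (i x) y = T.form x (q y) := by
  obtain ⟨i, hi, hsi, h1⟩ := h
  let q : H.space →ₗ[K] T.space :=
    (T.form.toDual hT).symm.toLinearMap ∘ₗ (H.form.flip.compl₂ i)
  have hq : ∀ x y, H.form (i x) y = T.form x (q y) := by
    intro x y
    rw [hsymm.eq]
    simp [q, LinearMap.BilinForm.apply_toDual_symm_apply]
  have inj : ∀ u v : T.space, (∀ x, T.form x u = T.form x v) → u = v := by
    intro u v huv
    refine sub_eq_zero.mp (hT.2 _ fun x => ?_)
    rw [map_sub, huv, sub_self]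
  refine ⟨i, q, hi, hsi, fun x => inj _ _ fun z => ?_, fun y => inj _ _ fun z => ?_,
    fun y => h1 _ fun x => ?_, hq⟩
  · rw [← hq, hi]
  · obtain ⟨z, rfl⟩ : ∃ z', (t : Module.End K T.space) z' = z :=
      ⟨((t⁻¹ : (Module.End K T.space)ˣ) : Module.End K T.space) z, by
        rw [← Module.End.mul_apply, Units.mul_inv, Module.End.one_apply]⟩
    rw [ht.1, ← hq, ← hsi, hs.1, hq]
  · rw [map_sub, hi, hq, sub_self]

variable {V W : Type u} [AddCommGroup V] [Module K V] [AddCommGroup W] [Module K W]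
  {s : Module.End K V} {t : Module.End K W} {i : W →ₗ[K] V} {q : V →ₗ[K] W}

theorem eigenspace_map_baseChange {E F : Type u} [AddCommGroup E] [Module K E] [AddCommGroup F]
    [Module K F] {a : Module.End K E} {b : Module.End K F} {f : E →ₗ[K] F}
    (hf : ∀ x, f (a x) = b (f x)) (L : Type u) [Field L] [Algebra K L] (x : L) {w : L ⊗[K] E}
    (hw : w ∈ Module.End.eigenspace (a.baseChange L) x) :
    f.baseChange L w ∈ Module.End.eigenspace (b.baseChange L) x := by
  have hf' : ∀ w, f.baseChange L (a.baseChange L w) = b.baseChange L (f.baseChange L w) := by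
    have : f ∘ₗ a = b ∘ₗ f := LinearMap.ext hf
    intro w
    rw [← LinearMap.comp_apply, ← LinearMap.comp_apply, ← LinearMap.baseChange_comp,
      ← LinearMap.baseChange_comp, this]
  rw [Module.End.mem_eigenspace_iff] at hw ⊢
  rw [← hf', hw, map_smul]

/-- An eigenvector of `s = (t, 1)` for an eigenvalue different from `1` has no component on which
`s` is the identity. -/
theorem baseChange_retraction_eq (hsi : ∀ x, s (i x) = i (t x))
    (hqs : ∀ y, q (s y) = t (q y)) (hs1 : ∀ y, s (y - i (q y)) = y - i (q y))
    (L : Type u) [Field L] [Algebra K L] {x : L} (hx : x ≠ 1) {w : L ⊗[K] V}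
    (hw : w ∈ Module.End.eigenspace (s.baseChange L) x) :
    i.baseChange L (q.baseChange L w) = w := by
  let p : V →ₗ[K] V := LinearMap.id - i ∘ₗ q
  have hf : ∀ y, p (s y) = (LinearMap.id : V →ₗ[K] V) (p y) := by
    intro y
    have := hs1 y
    rw [map_sub, hsi, ← hqs] at this
    simpa [p] using this
  have h := eigenspace_map_baseChange hf L x hw
  rw [Module.End.mem_eigenspace_iff, LinearMap.baseChange_id, LinearMap.id_apply] at h
  have h0 : p.baseChange L w = 0 := by
    have h2 : (1 - x) • p.baseChange L w = 0 :=
      (sub_smul 1 x (p.baseChange L w)).trans (by rw [one_smul, ← h, sub_self])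
    exact (smul_eq_zero.mp h2).resolve_left (sub_ne_zero.mpr hx.symm)
  rw [LinearMap.baseChange_sub, LinearMap.baseChange_id, LinearMap.baseChange_comp] at h0
  exact (sub_eq_zero.mp h0).symm

/-- The eigenvalues different from `1` of `t` and of `s = (t, 1)` agree. -/
theorem hasEigenvalue_baseChange_iff (hsi : ∀ x, s (i x) = i (t x)) (hqi : ∀ x, q (i x) = x)
    (hqs : ∀ y, q (s y) = t (q y)) (hs1 : ∀ y, s (y - i (q y)) = y - i (q y))
    (L : Type u) [Field L] [Algebra K L] {x : L} (hx : x ≠ 1) :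
    Module.End.HasEigenvalue (t.baseChange L) x ↔ Module.End.HasEigenvalue (s.baseChange L) x := by
  have hqi' : ∀ w, q.baseChange L (i.baseChange L w) = w := by
    have : q ∘ₗ i = LinearMap.id := LinearMap.ext hqi
    intro w
    rw [← LinearMap.comp_apply, ← LinearMap.baseChange_comp, this, LinearMap.baseChange_id,
      LinearMap.id_apply]
  constructor
  · intro h
    obtain ⟨w, hw, hw0⟩ := h.exists_hasEigenvector
    refine Module.End.hasEigenvalue_of_hasEigenvector (x := i.baseChange L w)
      ⟨eigenspace_map_baseChange (fun x => (hsi x).symm) L x hw, fun h0 => hw0 ?_⟩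
    rw [← hqi' w, h0, map_zero]
  · intro h
    obtain ⟨w, hw, hw0⟩ := h.exists_hasEigenvector
    refine Module.End.hasEigenvalue_of_hasEigenvector (x := q.baseChange L w)
      ⟨eigenspace_map_baseChange hqs L x hw, fun h0 => hw0 ?_⟩
    rw [← baseChange_retraction_eq hsi hqs hs1 L hx hw, h0, map_zero]

theorem map_mem_eigenvalueSpace {f : V →ₗ[K] W} (hf : ∀ x, f (s x) = t (f x))
    {O : Set (AlgebraicClosure K)} {v : V} (hv : v ∈ eigenvalueSpace s O) :
    f v ∈ eigenvalueSpace t O := by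
  have key : (⨆ x ∈ O, Module.End.eigenspace (s.baseChange (AlgebraicClosure K)) x) ≤
      (⨆ x ∈ O, Module.End.eigenspace (t.baseChange (AlgebraicClosure K)) x).comap
        (f.baseChange (AlgebraicClosure K)) :=
    iSup₂_le fun x hx w hw => Submodule.mem_iSup_of_mem x
      (Submodule.mem_iSup_of_mem hx (eigenspace_map_baseChange hf _ x hw))
  have h := key hv
  rwa [Submodule.mem_comap, TensorProduct.mk_apply, LinearMap.baseChange_tmul] at h

/-- For `s = (t, 1)` and `1 ∉ O`, the part of `s` that belongs to `O` lies in the space of `t`. -/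
theorem retraction_eq_of_mem_eigenvalueSpace (hsi : ∀ x, s (i x) = i (t x))
    (hqs : ∀ y, q (s y) = t (q y)) (hs1 : ∀ y, s (y - i (q y)) = y - i (q y))
    {O : Set (AlgebraicClosure K)} (hO : 1 ∉ O) {v : V} (hv : v ∈ eigenvalueSpace s O) :
    i (q v) = v := by
  have key : (⨆ x ∈ O, Module.End.eigenspace (s.baseChange (AlgebraicClosure K)) x) ≤
      LinearMap.eqLocus (i.baseChange (AlgebraicClosure K) ∘ₗ q.baseChange (AlgebraicClosure K))
        LinearMap.id :=
    iSup₂_le fun x hx w hw =>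
      baseChange_retraction_eq hsi hqs hs1 _ (fun h => hO (h ▸ hx)) hw
  have h := key hv
  rw [LinearMap.mem_eqLocus, TensorProduct.mk_apply, LinearMap.comp_apply,
    LinearMap.baseChange_tmul, LinearMap.baseChange_tmul, LinearMap.id_apply] at h
  exact Module.FaithfullyFlat.tensorProduct_mk_injective (A := K) (B := AlgebraicClosure K) V h

/-- For `s = (t, 1)` and a set `O` of eigenvalues that does not contain `1`, the parts of `t` and
`s` that belong to `O` agree. -/
def eigenvalueSpaceEquiv (hsi : ∀ x, s (i x) = i (t x)) (hqi : ∀ x, q (i x) = x)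
    (hqs : ∀ y, q (s y) = t (q y)) (hs1 : ∀ y, s (y - i (q y)) = y - i (q y))
    {O : Set (AlgebraicClosure K)} (hO : 1 ∉ O) :
    eigenvalueSpace t O ≃ₗ[K] eigenvalueSpace s O :=
  LinearEquiv.ofLinearMap
    (i.restrict fun _ hv => map_mem_eigenvalueSpace (fun x => (hsi x).symm) hv)
    (q.restrict fun _ hv => map_mem_eigenvalueSpace hqs hv)
    (LinearMap.ext fun v => Subtype.ext
      (retraction_eq_of_mem_eigenvalueSpace hsi hqs hs1 hO v.2))
    (LinearMap.ext fun v => Subtype.ext (hqi v))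

/-- For `s = (t, 1)` and a set `O` of eigenvalues that does not contain `1`, the factors of the
centralizers of `t` and `s` that belong to `O` are isomorphic. -/
def factorIso {H T : ClassicalGroup K} {s : Module.End K H.space} {t : Module.End K T.space}
    {i : T.space →ₗ[K] H.space} {q : H.space →ₗ[K] T.space}
    (hi : ∀ x y, H.form (i x) (i y) = T.form x y)
    (hsi : ∀ x, s (i x) = i (t x)) (hqi : ∀ x, q (i x) = x)
    (hqs : ∀ y, q (s y) = t (q y)) (hs1 : ∀ y, s (y - i (q y)) = y - i (q y))
    {O : Set (AlgebraicClosure K)} (hO : 1 ∉ O) : T.factor t O ≅ H.factor s O :=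
  centralizerIso (G₁ := T.part t .orthogonal O) (G₂ := H.part s .orthogonal O)
    (eigenvalueSpaceEquiv hsi hqi hqs hs1 hO) rfl (fun (x y : eigenvalueSpace t O) => hi x y)
    (fun (x : eigenvalueSpace t O) => Subtype.ext (hsi x).symm)

/-- The powers of the Frobenius endomorphism are injective, so that the class of `x ≠ 1` does not
contain `1`. -/
theorem one_notMem_eigenvalueClass [Finite K] {x : AlgebraicClosure K} (hx : x ≠ 1) :
    1 ∉ eigenvalueClass x := by
  rintro ⟨n, h⟩
  have h1 : x ^ (Nat.card K ^ n) = 1 := by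
    rcases h with h | h
    · exact h.symm
    · exact inv_eq_one.mp h.symm
  have := Fintype.ofFinite K
  obtain ⟨p, hp⟩ := CharP.exists K
  obtain ⟨m, hpp, hm⟩ := FiniteField.card K p
  have : Fact p.Prime := ⟨hpp⟩
  have : CharP (AlgebraicClosure K) p := charP_of_injective_algebraMap' K p
  rw [Nat.card_eq_fintype_card, hm, ← pow_mul] at h1
  exact hx (iterateFrobenius_inj (AlgebraicClosure K) p (m * n)
    (by simpa [iterateFrobenius_def] using h1))

/-- For `s = (t, 1)`, the groups `G_#` of `t` and `s` are isomorphic. -/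
def sharpIso [Finite K] {H T : ClassicalGroup K} {s : Module.End K H.space}
    {t : Module.End K T.space} {i : T.space →ₗ[K] H.space} {q : H.space →ₗ[K] T.space}
    (hi : ∀ x y, H.form (i x) (i y) = T.form x y)
    (hsi : ∀ x, s (i x) = i (t x)) (hqi : ∀ x, q (i x) = x)
    (hqs : ∀ y, q (s y) = t (q y)) (hs1 : ∀ y, s (y - i (q y)) = y - i (q y)) :
    T.sharp t ≅ H.sharp s :=
  Limits.Pi.whiskerEquiv
    (Equiv.subtypeEquivRight fun O => exists_congr fun x => and_congr_right fun hx =>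
      and_congr_right fun _ => and_congr_left fun _ =>
        hasEigenvalue_baseChange_iff hsi hqi hqs hs1 (AlgebraicClosure K) hx)
    fun O => (factorIso hi hsi hqi hqs hs1 (by
      obtain ⟨x, hx, -, -, hO⟩ := O.2
      exact hO ▸ one_notMem_eigenvalueClass hx)).symm

theorem eigenvalueClass_one : eigenvalueClass (1 : AlgebraicClosure K) = {1} := by
  ext y
  simp [eigenvalueClass]

theorem mem_eigenvalueSpace_one_iff (s : Module.End K V) (v : V) :
    v ∈ eigenvalueSpace s (eigenvalueClass 1) ↔ s v = v := by
  rw [eigenvalueClass_one, eigenvalueSpace, iSup_singleton, Submodule.mem_comap,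
    Submodule.restrictScalars_mem, Module.End.mem_eigenspace_iff, TensorProduct.mk_apply,
    LinearMap.baseChange_tmul, one_smul]
  exact (Module.FaithfullyFlat.tensorProduct_mk_injective
    (A := K) (B := AlgebraicClosure K) V).eq_iff

/-- For `s = (t, 1)` where `t` has no eigenvalue `1`, the fixed space of `s` is the orthogonal
complement of the space of `t`. -/
theorem eigenvalueSpace_one_eq_ker (ht1 : ¬ Module.End.HasEigenvalue t 1)
    (hqs : ∀ y, q (s y) = t (q y)) (hs1 : ∀ y, s (y - i (q y)) = y - i (q y)) :
    eigenvalueSpace s (eigenvalueClass 1) = LinearMap.ker q := by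
  ext v
  rw [mem_eigenvalueSpace_one_iff, LinearMap.mem_ker]
  constructor
  · intro h
    by_contra h0
    refine ht1 (Module.End.hasEigenvalue_of_hasEigenvector (x := q v) ⟨?_, h0⟩)
    rw [Module.End.mem_eigenspace_iff, one_smul, ← hqs, h]
  · intro h
    simpa [h] using hs1 v

theorem finrank_onePart {H T : ClassicalGroup K} {s : Module.End K H.space}
    {t : Module.End K T.space} {i : T.space →ₗ[K] H.space} {q : H.space →ₗ[K] T.space}
    (ht1 : ¬ Module.End.HasEigenvalue t 1) (hqi : ∀ x, q (i x) = x)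
    (hqs : ∀ y, q (s y) = t (q y)) (hs1 : ∀ y, s (y - i (q y)) = y - i (q y)) :
    Module.finrank K T.space + Module.finrank K (H.onePart s).space
      = Module.finrank K H.space := by
  change _ + Module.finrank K (eigenvalueSpace s (eigenvalueClass 1)) = _
  rw [eigenvalueSpace_one_eq_ker ht1 hqs hs1, ← LinearMap.finrank_range_add_finrank_ker q,
    LinearMap.range_eq_top.mpr fun x => ⟨i x, hqi x⟩, finrank_top]

/-- The fixed space of `s = (t, 1)` is nondegenerate, as an orthogonal direct summand of a
nondegenerate space. -/
theorem onePart_nondegenerate {H T : ClassicalGroup K} {s : Module.End K H.space}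
    {t : Module.End K T.space} {i : T.space →ₗ[K] H.space} {q : H.space →ₗ[K] T.space}
    (hsymm : H.form.IsSymm) (hH : H.form.Nondegenerate)
    (hadj : ∀ x y, H.form (i x) y = T.form x (q y))
    (ht1 : ¬ Module.End.HasEigenvalue t 1) (hqi : ∀ x, q (i x) = x)
    (hqs : ∀ y, q (s y) = t (q y)) (hs1 : ∀ y, s (y - i (q y)) = y - i (q y)) :
    (H.onePart s).form.Nondegenerate := by
  have key : ∀ v : (H.onePart s).space, (∀ w, (H.onePart s).form v w = 0) → v = 0 := by
    rintro ⟨v, hv⟩ h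
    refine Subtype.ext (hH.1 v fun y => ?_)
    have hv' : q v = 0 := by
      rwa [eigenvalueSpace_one_eq_ker ht1 hqs hs1, LinearMap.mem_ker] at hv
    have hy : y - i (q y) ∈ eigenvalueSpace s (eigenvalueClass 1) := by
      rw [eigenvalueSpace_one_eq_ker ht1 hqs hs1, LinearMap.mem_ker, map_sub, hqi, sub_self]
    have h1 : H.form v (y - i (q y)) = 0 := h ⟨_, hy⟩
    rw [map_sub, hsymm.eq v (i (q y)), hadj, hv', map_zero, sub_zero] at h1
    exact h1
  refine ⟨key, fun v h => key v fun w => ?_⟩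
  rw [← h w]
  exact hsymm.eq _ _

end BlockSum

/-! ### The commutants of symplectic and orthogonal groups -/

section Commutant

variable {L : Type u} [Field L] {W E : Type u} [AddCommGroup W] [Module L W]
  [AddCommGroup E] [Module L E]

/-- An endomorphism of `W ⊗ E` that commutes with all `1 ⊗ (φ · • v)` is of the form `g ⊗ 1`: if
`φ u = 1`, then `x ⊗ v` is the image of `x ⊗ u` under `1 ⊗ (φ · • v)`, an operator with values in
`W ⊗ v`. -/
theorem exists_eq_rTensor_of_commute [Nontrivial E] {f : Module.End L (W ⊗[L] E)}
    (h : ∀ (φ : E →ₗ[L] L) (v : E),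
      f * (φ.smulRight v).lTensor W = (φ.smulRight v).lTensor W * f) :
    ∃ g : Module.End L W, f = g.rTensor E := by
  obtain ⟨u, hu⟩ := exists_ne (0 : E)
  obtain ⟨φ, hφ⟩ := Module.Projective.exists_dual_eq_one L hu
  refine ⟨(TensorProduct.rid L W).toLinearMap ∘ₗ φ.lTensor W ∘ₗ f ∘ₗ
    (TensorProduct.mk L W E).flip u, TensorProduct.ext' fun x v => ?_⟩
  have key : ∀ y : W ⊗[L] E, (φ.smulRight v).lTensor W y
      = (TensorProduct.rid L W (φ.lTensor W y)) ⊗ₜ[L] v := by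
    intro y
    induction y with
    | zero => simp
    | add y z hy hz => simp only [map_add, hy, hz, TensorProduct.add_tmul]
    | tmul a b => simp [TensorProduct.smul_tmul]
  have e := LinearMap.congr_fun (h φ v) (x ⊗ₜ u)
  rw [Module.End.mul_apply, Module.End.mul_apply, key] at e
  rw [LinearMap.lTensor_tmul, hφ, TensorProduct.rid_tmul, one_smul, key] at e
  exact e

/-- The mirror image of `exists_eq_rTensor_of_commute`. -/
theorem exists_eq_lTensor_of_commute [Nontrivial W] {f : Module.End L (W ⊗[L] E)}
    (h : ∀ (φ : W →ₗ[L] L) (v : W),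
      f * (φ.smulRight v).rTensor E = (φ.smulRight v).rTensor E * f) :
    ∃ g : Module.End L E, f = g.lTensor W := by
  obtain ⟨u, hu⟩ := exists_ne (0 : W)
  obtain ⟨φ, hφ⟩ := Module.Projective.exists_dual_eq_one L hu
  refine ⟨(TensorProduct.lid L E).toLinearMap ∘ₗ φ.rTensor E ∘ₗ f ∘ₗ
    TensorProduct.mk L W E u, TensorProduct.ext' fun v x => ?_⟩
  have key : ∀ y : W ⊗[L] E, (φ.smulRight v).rTensor E y
      = v ⊗ₜ[L] (TensorProduct.lid L E (φ.rTensor E y)) := by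
    intro y
    induction y with
    | zero => simp
    | add y z hy hz => simp only [map_add, hy, hz, TensorProduct.tmul_add]
    | tmul a b => simp [TensorProduct.smul_tmul]
  have e := LinearMap.congr_fun (h φ v) (u ⊗ₜ x)
  rw [Module.End.mul_apply, Module.End.mul_apply, key] at e
  rw [LinearMap.rTensor_tmul, hφ, TensorProduct.lid_tmul, one_smul, key] at e
  exact e

variable [FiniteDimensional L E] {β : LinearMap.BilinForm L E}

theorem exists_unit_of_isometry (hβ : β.Nondegenerate) {g : Module.End L E}
    (hg : ∀ x y, β (g x) (g y) = β x y) :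
    ∃ u : LinearMap.GeneralLinearGroup L E, (u : Module.End L E) = g := by
  have : IsUnit g := by
    rw [LinearMap.isUnit_iff_ker_eq_bot, LinearMap.ker_eq_bot']
    intro x hx
    refine hβ.1 x fun y => ?_
    rw [← hg, hx, map_zero, LinearMap.zero_apply]
  exact this

/-- A subalgebra of `End E` that contains the operators `β v · • v` for the vectors `v` of a
spanning set in which any two vectors have a common nonorthogonal neighbour contains all operators
of rank one: products of three such operators give the mixed operators `β w · • v`. -/
theorem smulRight_mem_of_span (hβ : β.Nondegenerate) (C : Subalgebra L (Module.End L E))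
    {S : Set E} (hS : Submodule.span L S = ⊤) (hC : ∀ v ∈ S, (β v).smulRight v ∈ C)
    (hu : ∀ v ∈ S, ∀ w ∈ S, ∃ u ∈ S, β v u ≠ 0 ∧ β u w ≠ 0) (φ : E →ₗ[L] L) (v : E) :
    φ.smulRight v ∈ C := by
  obtain ⟨w, rfl⟩ := (β.toDual hβ).surjective φ
  have hw : β.toDual hβ w = β w := LinearMap.ext fun _ => LinearMap.BilinForm.toDual_def hβ
  rw [hw]
  let Θ : E →ₗ[L] E →ₗ[L] Module.End L E := (LinearMap.smulRightₗ : _ →ₗ[L] E →ₗ[L] _) ∘ₗ β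
  refine LinearMap.BilinMap.apply_apply_mem_of_mem_span (Subalgebra.toSubmodule C) S S Θ ?_ w v
    (hS ▸ Submodule.mem_top) (hS ▸ Submodule.mem_top)
  intro w hw v hv
  obtain ⟨u, hu, h1, h2⟩ := hu v hv w hw
  have h3 := C.smul_mem (C.mul_mem (C.mul_mem (hC v hv) (hC u hu)) (hC w hw))
    ((β v u * β u w)⁻¹)
  convert (show _ ∈ Subalgebra.toSubmodule C from h3) using 1
  refine LinearMap.ext fun x => ?_
  have h4 : (β v u * β u w)⁻¹ * (β w x * (β u w * β v u)) = β w x := by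
    field_simp
  simp only [LinearMap.smul_apply, Module.End.mul_apply, LinearMap.smulRight_apply, map_smul,
    smul_smul]
  rw [h4]
  rfl

/-- The symplectic group spans the algebra of all endomorphisms: the transvections `1 + β v · • v`
are isometries, and their span contains the operators `β v · • v`. -/
theorem smulRight_mem_of_transvections (halt : β.IsAlt) (hβ : β.Nondegenerate)
    (C : Subalgebra L (Module.End L E))
    (hC : ∀ g : Module.End L E, (∀ x y, β (g x) (g y) = β x y) → g ∈ C)
    (φ : E →ₗ[L] L) (v : E) : φ.smulRight v ∈ C := by
  have hex : ∀ v : E, v ≠ 0 → ∃ u, β v u ≠ 0 := by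
    intro v hv
    by_contra! h
    exact hv (hβ.1 v h)
  refine smulRight_mem_of_span hβ C (S := {v | v ≠ 0}) ?_ (fun v _ => ?_)
    (fun v hv w hw => ?_) φ v
  · refine eq_top_iff.mpr fun v _ => ?_
    by_cases hv : v = 0
    · rw [hv]
      exact Submodule.zero_mem _
    · exact Submodule.subset_span hv
  · have h := hC (1 + (β v).smulRight v) fun x y => by
      have hxv : β x v = -β v x := (halt.neg_eq v x).symm
      simp only [LinearMap.add_apply, Module.End.one_apply, LinearMap.smulRight_apply, map_add,
        map_smul, LinearMap.smul_apply, smul_eq_mul, halt.self_eq_zero, hxv]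
      ring
    simpa using C.sub_mem h C.one_mem
  · obtain ⟨u₁, h₁⟩ := hex v hv
    obtain ⟨u₂, h₂⟩ := hex w hw
    have key : ∃ u, β v u ≠ 0 ∧ β w u ≠ 0 := by
      by_cases h₃ : β w u₁ = 0
      · by_cases h₄ : β v u₂ = 0
        · exact ⟨u₁ + u₂, by simpa [h₄] using h₁, by simpa [h₃] using h₂⟩
        · exact ⟨u₂, h₄, h₂⟩
      · exact ⟨u₁, h₁, h₃⟩
    obtain ⟨u, h₃, h₄⟩ := key
    refine ⟨u, fun h => h₃ (by rw [h, map_zero]), h₃, ?_⟩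
    rw [← halt.neg_eq]
    exact neg_ne_zero.mpr h₄

/-- The orthogonal group spans the algebra of all endomorphisms: the span of the reflections in
nonisotropic vectors `v` contains the operators `β v · • v`. -/
theorem smulRight_mem_of_reflections [IsAlgClosed L] (h2 : (2 : L) ≠ 0) (hsymm : β.IsSymm)
    (hβ : β.Nondegenerate) (C : Subalgebra L (Module.End L E))
    (hC : ∀ g : Module.End L E, (∀ x y, β (g x) (g y) = β x y) → g ∈ C)
    (φ : E →ₗ[L] L) (v : E) : φ.smulRight v ∈ C := by
  refine smulRight_mem_of_span hβ C (S := {v | β v v ≠ 0}) ?_ (fun v hv => ?_)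
    (fun v hv w hw => ?_) φ v
  · have := invertibleOfNonzero h2
    obtain ⟨b, hb⟩ := LinearMap.BilinForm.exists_orthogonal_basis (B := β) ⟨hsymm.eq⟩
    refine eq_top_iff.mpr (b.span_eq ▸ Submodule.span_mono ?_)
    rintro _ ⟨i, rfl⟩
    exact hb.not_isOrtho_basis_self_of_separatingLeft hβ.1 i
  · have hv : β v v ≠ 0 := hv
    -- The reflection in `v`.
    have h := hC (1 - (2 / β v v) • (β v).smulRight v) fun x y => by
      simp only [LinearMap.sub_apply, Module.End.one_apply, LinearMap.smulRight_apply, map_sub,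
        map_smul, LinearMap.smul_apply, smul_eq_mul, hsymm.eq x v]
      field_simp
      ring
    have h' := C.smul_mem (C.sub_mem C.one_mem h) (β v v / 2)
    rw [sub_sub_cancel, smul_smul, div_mul_div_cancel₀ h2, div_self hv, one_smul] at h'
    exact h'
  · have hv : β v v ≠ 0 := hv
    have hw : β w w ≠ 0 := hw
    by_cases hvw : β v w = 0
    -- A common neighbour `v + t • w` of two orthogonal vectors has to be nonisotropic, that is,
    -- `t ^ 2 ≠ -β v v / β w w`.
    · obtain ⟨d, hd⟩ := (Set.toFinite {0, -β v v / β w w}).exists_notMem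
      simp only [Set.mem_insert_iff, Set.mem_singleton_iff, not_or] at hd
      obtain ⟨t, rfl⟩ := IsAlgClosed.exists_pow_nat_eq d two_pos
      have ht : t ≠ 0 := fun h => hd.1 (by simp [h])
      have hwv : β w v = 0 := by rw [hsymm.eq, hvw]
      refine ⟨v + t • w, fun h => hd.2 ?_, ?_, ?_⟩
      · rw [eq_div_iff hw]
        simp only [map_add, map_smul, LinearMap.add_apply, LinearMap.smul_apply, hvw, hwv,
          smul_eq_mul] at h
        linear_combination h
      · simpa [hvw] using hv
      · simpa [hvw] using ⟨ht, hw⟩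
    · exact ⟨v, hv, hv, hvw⟩

end Commutant

/-! ### Symplectic-orthogonal dual pairs -/

section Pairs

variable {L : Type u} [Field L]

theorem tensor_form_tmul (G G' : ClassicalGroup L) (x y : G.space) (v w : G'.space) :
    LinearMap.BilinForm.tmul G.form G'.form (x ⊗ₜ v) (y ⊗ₜ w) = G'.form v w * G.form x y :=
  rfl

theorem tensor_form_map {G G' : ClassicalGroup L} {g : Module.End L G.space}
    {g' : Module.End L G'.space} (hg : ∀ x y, G.form (g x) (g y) = G.form x y)
    (hg' : ∀ x y, G'.form (g' x) (g' y) = G'.form x y) (x y : G.space ⊗[L] G'.space) :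
    LinearMap.BilinForm.tmul G.form G'.form (TensorProduct.map g g' x) (TensorProduct.map g g' y)
      = LinearMap.BilinForm.tmul G.form G'.form x y := by
  induction x with
  | zero => simp
  | add x x' hx hx' => simp only [map_add, LinearMap.add_apply, hx, hx']
  | tmul a v =>
    induction y with
    | zero => simp
    | add y y' hy hy' => simp only [map_add, hy, hy']
    | tmul b w => rw [TensorProduct.map_tmul, TensorProduct.map_tmul, tensor_form_tmul,
        tensor_form_tmul, hg, hg']

/-- Over an algebraically closed field of characteristic different from `2`, the symplectic and the
orthogonal group are each other's centralizers in the symplectic group of the tensor product,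
because each of them spans the algebra of all endomorphisms of its space. -/
theorem mutualCentralizers [IsAlgClosed L] (h2 : (2 : L) ≠ 0) {G G' : ClassicalGroup L}
    (hk : G.kind = .symplectic) (halt : G.form.IsAlt) (hG : G.form.Nondegenerate)
    (hk' : G'.kind = .orthogonal) (hsymm : G'.form.IsSymm) (hG' : G'.form.Nondegenerate) :
    MutualCentralizers G G' := by
  have hcomm : ∀ (a : G.points) (b : G'.points),
      (a : LinearMap.GeneralLinearGroup L G.space).1.rTensor G'.space *
        (b : LinearMap.GeneralLinearGroup L G'.space).1.lTensor G.space =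
      (b : LinearMap.GeneralLinearGroup L G'.space).1.lTensor G.space *
        (a : LinearMap.GeneralLinearGroup L G.space).1.rTensor G'.space := by
    intro a b
    exact (LinearMap.rTensor_comp_lTensor ..).trans (LinearMap.lTensor_comp_rTensor ..).symm
  constructor
  · refine le_antisymm ?_ ?_
    · rintro _ ⟨a, ha, rfl⟩
      refine ⟨⟨tensor_form_map ha.1 fun _ _ => rfl, fun h => nomatch h⟩, ?_⟩
      rintro _ ⟨b, hb, rfl⟩
      exact Units.ext (hcomm ⟨a, ha⟩ ⟨b, hb⟩).symm
    · rintro f ⟨⟨hf, -⟩, hfc⟩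
      -- In rank `0` the tensor product vanishes, and every group acting on it has trivial image.
      rcases subsingleton_or_nontrivial G'.space with hE | hE
      · exact ⟨1, G.points.one_mem, Units.ext (LinearMap.ext fun x =>
          Subsingleton.elim (α := G.space ⊗[L] G'.space) _ _)⟩
      · obtain ⟨g, hg⟩ := exists_eq_rTensor_of_commute (f := f.1) fun φ v =>
          smulRight_mem_of_reflections h2 hsymm hG'
          ((Subalgebra.centralizer L {f.1}).comap (Module.End.lTensorAlgHom L G'.space G.space))
          (fun b hb => by
            obtain ⟨b, rfl⟩ := exists_unit_of_isometry hG' hb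
            rintro _ rfl
            exact (congrArg Units.val
              (hfc _ ⟨b, ⟨hb, fun h => by simp [hk'] at h⟩, rfl⟩)).symm) φ v _ rfl
        obtain ⟨u, hu⟩ := exists_ne (0 : G'.space)
        obtain ⟨w, hw⟩ : ∃ w, G'.form u w ≠ 0 := by
          by_contra! h
          exact hu (hG'.1 u h)
        have hgi : ∀ x y, G.form (g x) (g y) = G.form x y := by
          intro x y
          have e := hf (x ⊗ₜ u) (y ⊗ₜ w)
          rw [hg] at e
          exact mul_left_cancel₀ hw e
        obtain ⟨a, rfl⟩ := exists_unit_of_isometry hG hgi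
        exact ⟨a, ⟨hgi, fun h => by simp [hk] at h⟩, Units.ext hg.symm⟩
  · refine le_antisymm ?_ ?_
    · rintro _ ⟨b, hb, rfl⟩
      refine ⟨⟨tensor_form_map (fun _ _ => rfl) hb.1, fun h => nomatch h⟩, ?_⟩
      rintro _ ⟨a, ha, rfl⟩
      exact Units.ext (hcomm ⟨a, ha⟩ ⟨b, hb⟩)
    · rintro f ⟨⟨hf, -⟩, hfc⟩
      -- In rank `0` the tensor product vanishes, and every group acting on it has trivial image.
      rcases subsingleton_or_nontrivial G.space with hE | hE
      · exact ⟨1, G'.points.one_mem, Units.ext (LinearMap.ext fun x =>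
          Subsingleton.elim (α := G.space ⊗[L] G'.space) _ _)⟩
      · obtain ⟨g, hg⟩ := exists_eq_lTensor_of_commute (f := f.1) fun φ v =>
          smulRight_mem_of_transvections halt hG
          ((Subalgebra.centralizer L {f.1}).comap (Module.End.rTensorAlgHom L G.space G'.space))
          (fun b hb => by
            obtain ⟨b, rfl⟩ := exists_unit_of_isometry hG hb
            rintro _ rfl
            exact (congrArg Units.val
              (hfc _ ⟨b, ⟨hb, fun h => by simp [hk] at h⟩, rfl⟩)).symm) φ v _ rfl
        obtain ⟨u, hu⟩ := exists_ne (0 : G.space)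
        obtain ⟨w, hw⟩ : ∃ w, G.form u w ≠ 0 := by
          by_contra! h
          exact hu (hG.1 u h)
        have hgi : ∀ x y, G'.form (g x) (g y) = G'.form x y := by
          intro x y
          have e := hf (u ⊗ₜ x) (w ⊗ₜ y)
          rw [hg] at e
          exact mul_right_cancel₀ hw e
        obtain ⟨b, rfl⟩ := exists_unit_of_isometry hG' hgi
        exact ⟨b, ⟨hgi, fun h => by simp [hk'] at h⟩, Units.ext hg.symm⟩

variable {K : Type u} [Field K] {V : Type u} [AddCommGroup V] [Module K V]
  {β : LinearMap.BilinForm K V}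

/-- In characteristic different from `2`, being alternating is being antisymmetric, which can be
checked on pure tensors. -/
theorem baseChange_isAlt [Algebra K L] (h2 : (2 : K) ≠ 0) (h : β.IsAlt) :
    (LinearMap.BilinForm.baseChange L β).IsAlt := by
  have hskew : ∀ x y, LinearMap.BilinForm.baseChange L β x y
      = -LinearMap.BilinForm.baseChange L β y x := by
    intro x y
    induction x with
    | zero => simp
    | add x x' hx hx' => rw [map_add, LinearMap.add_apply, hx, hx', map_add, neg_add]
    | tmul a v =>
      induction y with
      | zero => simp
      | add y y' hy hy' => rw [map_add, hy, hy', map_add, LinearMap.add_apply, neg_add]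
      | tmul b w => simp [← h.neg_eq v w, mul_comm a b]
  have h2' : (2 : L) ≠ 0 := by
    rw [← map_ofNat (algebraMap K L) 2]
    exact (map_ne_zero _).mpr h2
  intro x
  have e := hskew x x
  rw [eq_neg_iff_add_eq_zero, ← two_mul] at e
  exact (mul_eq_zero.mp e).resolve_left h2'

theorem baseChange_nondegenerate [FiniteDimensional K V] [Algebra K L] (h : β.Nondegenerate) :
    (LinearMap.BilinForm.baseChange L β).Nondegenerate := by
  let b := Module.finBasis K V
  rw [← LinearMap.BilinForm.nondegenerate_toMatrix_iff b,
    Matrix.nondegenerate_iff_det_ne_zero] at h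
  rw [← LinearMap.BilinForm.nondegenerate_toMatrix_iff (b.baseChange L),
    Matrix.nondegenerate_iff_det_ne_zero]
  have e : LinearMap.BilinForm.toMatrix (b.baseChange L) (LinearMap.BilinForm.baseChange L β)
      = (algebraMap K L).mapMatrix (LinearMap.BilinForm.toMatrix b β) := by
    ext i j
    simp [LinearMap.BilinForm.toMatrix_apply, Algebra.algebraMap_eq_smul_one]
  rw [e, ← RingHom.map_det]
  exact (map_ne_zero _).mpr h

theorem isSymplecticOrthogonalDualPair (h2 : (2 : K) ≠ 0) {G G' : ClassicalGroup K}
    (hk : G.kind = .symplectic) (halt : G.form.IsAlt) (hG : G.form.Nondegenerate)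
    (hk' : G'.kind = .orthogonal) (hsymm : G'.form.IsSymm) (hG' : G'.form.Nondegenerate)
    (heven : Even (Module.finrank K G'.space)) : IsSymplecticOrthogonalDualPair G G' where
  kind_left := hk
  alt_left := halt
  nondegenerate_left := hG
  kind_right := hk'
  symm_right := hsymm
  nondegenerate_right := hG'
  even_right := heven
  centralizers := by
    have h2' : (2 : AlgebraicClosure K) ≠ 0 := by
      rw [← map_ofNat (algebraMap K (AlgebraicClosure K)) 2]
      exact (map_ne_zero _).mpr h2
    exact mutualCentralizers h2' hk (baseChange_isAlt h2 halt) (baseChange_nondegenerate hG) hk'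
      ⟨(LinearMap.BilinForm.IsSymm.baseChange (AlgebraicClosure K) ⟨hsymm.eq⟩).eq⟩
      (baseChange_nondegenerate hG')

end Pairs

/-! ### Dual groups -/

section DualForms

variable {K : Type u} [Field K] {G : ClassicalGroup K}

theorem dual_of_orthogonal (hk : G.kind = .orthogonal) : G.dual = G := by
  obtain ⟨k, V, β⟩ := G
  cases hk
  rfl

theorem dual_of_specialOrthogonal (hk : G.kind = .specialOrthogonal) :
    G.dual.kind = .symplectic ∧ G.dual.form.IsAlt ∧ G.dual.form.Nondegenerate := by
  obtain ⟨k, V, β⟩ := G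
  cases hk
  refine ⟨rfl, fun v => ?_, fun v h => ?_, fun v h => ?_⟩
  · change v.1 ⬝ᵥ v.2 - v.2 ⬝ᵥ v.1 = 0
    rw [dotProduct_comm, sub_self]
  · replace h : ∀ w₁ w₂, v.1 ⬝ᵥ w₂ - v.2 ⬝ᵥ w₁ = 0 := fun w₁ w₂ => h (w₁, w₂)
    refine Prod.ext (dotProduct_eq_zero _ fun w => ?_) (dotProduct_eq_zero _ fun w => ?_)
    · simpa using h 0 w
    · simpa using h w 0
  · replace h : ∀ w₁ w₂, w₁ ⬝ᵥ v.2 - w₂ ⬝ᵥ v.1 = 0 := fun w₁ w₂ => h (w₁, w₂)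
    refine Prod.ext (dotProduct_eq_zero _ fun w => ?_) (dotProduct_eq_zero _ fun w => ?_)
    · simpa [dotProduct_comm] using h 0 w
    · simpa [dotProduct_comm] using h w 0

theorem dual_of_symplectic (hk : G.kind = .symplectic) :
    G.dual.kind = .specialOrthogonal ∧ G.dual.form.IsSymm ∧ G.dual.form.Nondegenerate ∧
      Odd (Module.finrank K G.dual.space) := by
  obtain ⟨k, V, β⟩ := G
  cases hk
  let n := Module.finrank K V / 2
  have key : ∀ v w : ((Fin n → K) × (Fin n → K)) × K,
      v.1.1 ⬝ᵥ w.1.2 + v.1.2 ⬝ᵥ w.1.1 + v.2 * w.2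
        = w.1.1 ⬝ᵥ v.1.2 + w.1.2 ⬝ᵥ v.1.1 + w.2 * v.2 := by
    intro v w
    rw [dotProduct_comm v.1.1, dotProduct_comm v.1.2, mul_comm v.2, add_comm (w.1.2 ⬝ᵥ _)]
  have sep : ∀ v : ((Fin n → K) × (Fin n → K)) × K,
      (∀ w : ((Fin n → K) × (Fin n → K)) × K,
        v.1.1 ⬝ᵥ w.1.2 + v.1.2 ⬝ᵥ w.1.1 + v.2 * w.2 = 0) → v = 0 := by
    intro v h
    refine Prod.ext (Prod.ext (dotProduct_eq_zero _ fun w => ?_)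
      (dotProduct_eq_zero _ fun w => ?_)) ?_
    · simpa using h ((0, w), 0)
    · simpa using h ((w, 0), 0)
    · simpa using h (0, 1)
  refine ⟨rfl, ⟨key⟩, ⟨sep, fun v h => sep v fun w => (key v w).trans (h w)⟩, n, ?_⟩
  change Module.finrank K (((Fin n → K) × (Fin n → K)) × K) = _
  simp [two_mul]

end DualForms

/-! ### Reduction to the block of the eigenvalue one -/

section Reduction

variable {K : Type u} [Field K]

theorem onePart_isInDualFamily_of_specialOrthogonal {H : ClassicalGroup K}
    {s : Module.End K H.space} (hk : H.kind = .specialOrthogonal) (hsymm : H.form.IsSymm)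
    (hnd : (H.onePart s).form.Nondegenerate) (hodd : Odd (Module.finrank K (H.onePart s).space)) :
    (H.onePart s).IsInDualFamily := by
  refine ⟨hnd, ?_⟩
  have hk' : (H.onePart s).kind = .specialOrthogonal := hk
  rw [hk']
  exact ⟨⟨fun x y => hsymm.eq _ _⟩, hodd⟩

theorem onePart_isInDualFamily_of_orthogonal {H : ClassicalGroup K}
    {s : Module.End K H.space} (hk : H.kind = .orthogonal) (hsymm : H.form.IsSymm)
    (hnd : (H.onePart s).form.Nondegenerate)
    (heven : Even (Module.finrank K (H.onePart s).space)) :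
    (H.onePart s).IsInDualFamily := by
  refine ⟨hnd, ?_⟩
  have hk' : (H.onePart s).kind = .orthogonal := hk
  rw [hk']
  exact ⟨⟨fun x y => hsymm.eq _ _⟩, heven⟩

end Reduction

end ClassicalGroup

end

theorem mainTheorem4 {K : Type u} [Field K] [Finite K] (hK : (2 : K) ≠ 0)
    (G G' : ClassicalGroup K) (hpair : ClassicalGroup.IsSymplecticOrthogonalDualPair G G')
    (s : LinearMap.GeneralLinearGroup K G.dual.space) (hs : s ∈ G.dual.points)
    (hs_semisimple : Module.End.IsSemisimple (s : Module.End K G.dual.space))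
    (s' : LinearMap.GeneralLinearGroup K G'.dual.space) (hs' : s' ∈ G'.dual.points)
    (hs'_semisimple : Module.End.IsSemisimple (s' : Module.End K G'.dual.space))
    (hrel : ClassicalGroup.HoweRelated G.dual G'.dual s s') :
    Nonempty (G.dual.sharp (s : Module.End K G.dual.space) ≅
        G'.dual.sharp (s' : Module.End K G'.dual.space)) ∧
      Nonempty (G.dual.minusOnePart (s : Module.End K G.dual.space) ≅
        G'.dual.minusOnePart (s' : Module.End K G'.dual.space)) ∧
      (G.dual.onePart (s : Module.End K G.dual.space)).IsInDualFamily ∧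
      (G'.dual.onePart (s' : Module.End K G'.dual.space)).IsInDualFamily ∧
      ClassicalGroup.IsSymplecticOrthogonalDualPair
        (G.dual.onePart (s : Module.End K G.dual.space)).dual
        (G'.dual.onePart (s' : Module.End K G'.dual.space)).dual := by
  obtain ⟨hHk, hHsymm, hHnd, hHodd⟩ := ClassicalGroup.dual_of_symplectic hpair.kind_left
  have hG' : G'.dual = G' := ClassicalGroup.dual_of_orthogonal hpair.kind_right
  have hHk' : G'.dual.kind = .orthogonal := hG'.symm ▸ hpair.kind_right
  have hHsymm' : G'.dual.form.IsSymm := hG'.symm ▸ hpair.symm_right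
  have hHnd' : G'.dual.form.Nondegenerate := hG'.symm ▸ hpair.nondegenerate_right
  have hHeven : Even (Module.finrank K G'.dual.space) := hG'.symm ▸ hpair.even_right
  obtain ⟨T, -, hTsymm, hTnd, ⟨l, hl⟩, t, ht, -, ht1, hb, hb'⟩ := hrel
  obtain ⟨i, q, hi, hsi, hqi, hqs, hs1, hadj⟩ := hb.exists_retraction hs ht hTsymm hTnd
  obtain ⟨i', q', hi', hsi', hqi', hqs', hs1', hadj'⟩ :=
    hb'.exists_retraction hs' ht hTsymm hTnd
  have hneg : (1 : AlgebraicClosure K) ∉ ClassicalGroup.eigenvalueClass (-1) := by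
    refine ClassicalGroup.one_notMem_eigenvalueClass fun h => hK ?_
    have h2 : algebraMap K (AlgebraicClosure K) 2 = 0 := by
      rw [map_ofNat]
      linear_combination -h
    exact (map_eq_zero _).mp h2
  have hd := ClassicalGroup.finrank_onePart ht1 hqi hqs hs1
  have hd' := ClassicalGroup.finrank_onePart ht1 hqi' hqs' hs1'
  have hnd := ClassicalGroup.onePart_nondegenerate hHsymm hHnd hadj ht1 hqi hqs hs1
  have hnd' := ClassicalGroup.onePart_nondegenerate hHsymm' hHnd' hadj' ht1 hqi' hqs' hs1'
  have hodd : Odd (Module.finrank K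
      (G.dual.onePart (s : Module.End K G.dual.space)).space) := by
    rw [Nat.odd_iff] at hHodd ⊢
    omega
  have heven : Even (Module.finrank K
      (G'.dual.onePart (s' : Module.End K G'.dual.space)).space) := by
    rw [Nat.even_iff] at hHeven ⊢
    omega
  refine ⟨⟨(ClassicalGroup.sharpIso hi hsi hqi hqs hs1).symm ≪≫
      ClassicalGroup.sharpIso hi' hsi' hqi' hqs' hs1'⟩,
    ⟨(ClassicalGroup.factorIso hi hsi hqi hqs hs1 hneg).symm ≪≫
      ClassicalGroup.factorIso hi' hsi' hqi' hqs' hs1' hneg⟩,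
    ClassicalGroup.onePart_isInDualFamily_of_specialOrthogonal hHk hHsymm hnd hodd,
    ClassicalGroup.onePart_isInDualFamily_of_orthogonal hHk' hHsymm' hnd' heven, ?_⟩
  obtain ⟨hk, halt, hnd₁⟩ := ClassicalGroup.dual_of_specialOrthogonal
    (G := G.dual.onePart (s : Module.End K G.dual.space)) hHk
  rw [ClassicalGroup.dual_of_orthogonal
    (G := G'.dual.onePart (s' : Module.End K G'.dual.space)) hHk']
  exact ClassicalGroup.isSymplecticOrthogonalDualPair hK hk halt hnd₁ hHk'
    ⟨fun x y => hHsymm'.eq _ _⟩ hnd' heven
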